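/- Let $X\neq\{0\}$ be a finite-dimensional normed space over $\mathbb R$ and let $\Phi$ be a stable linear flow on $X$, i.e. $\Phi:\mathbb R\times X\to X$ is continuous, $\Phi_0=\mathrm{id}$, $\Phi_{t+s}=\Phi_t\circ\Phi_s$, every $\Phi_t$ is linear, and $\lim_{t\to\infty}\Phi_t x=0$ for every $x\in X$. Let $\mathcal R$ be the set of all continuous $\rho:\mathbb R\to\mathbb R$ with $\lim_{t\to\infty}\rho(t)=\infty$. For $\delta>0$ call $x\in X$ *$\delta$-distorting* if for every $\varepsilon>0$ there is a $y\neq 0$ with $|y-x|<\varepsilon$ such that $$\limsup_{t\to\infty}\frac{|\Phi_t x-\Phi_{\rho(t)}y|}{|\Phi_{\rho(t)}y|}\ \ge\ \delta\qquad\text{for all }\rho\in\mathcal R ,$$ and let $D^\Phi$ be the set of *distortion points*, i.e. of those $x\in X$ that are $\delta$-distorting for some $\delta>0$. For $x\ne0$ let $\lambda_+^\Phi(x)=\limsup_{t\to\infty}\frac1t\log|\Phi_t x|$ be the Lyapunov exponent at $x$ (for linear flows in finite dimension this upper limit is in fact a limit), let $\lambda_+^\Phi(0)=-\infty$, and for $s\in\mathbb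 R$, $m\in\{0,1,2,\dots\}$ let $$L^\Phi(s)=\{x\in X:\lambda_+^\Phi(x)\le s\},\qquad L_m^\Phi(s)=\Bigl\{x\in X:\lim_{t\to\infty}\frac{\Phi_t x}{e^{st}t^m}=0\Bigr\}.$$ Let $\lambda^\Phi=\max_{x\neq0}\lambda_+^\Phi(x)$ and $m^\Phi=\min\{m\ge 0: L_m^\Phi(\lambda^\Phi)=L^\Phi(\lambda^\Phi)\}$. Then $$D^\Phi=L^\Phi_{m^\Phi-1}(\lambda^\Phi).$$ In particular, $D^\Phi$ is a linear subspace of $X$, it is proper ($D^\Phi\ne X$), and it is $\Phi$-invariant ($\Phi_tD^\Phi=D^\Phi$ for all $t\in\mathbb R$). Here $\lambda^\Phi$ and $m^\Phi$ are well defined (the maximum and the minimum exist), $m^\Phi\ge1$, and moreover $\lambda^\Phi=\min\{s\in\mathbb R:L^\Phi(s)=X\}$ and $m^\Phi=\min\{m\ge0:L_m^\Phi(\lambda^\Phi)=X\}$. Writing $\Phi_t=e^{tA}$ with the generator $A$ of $\Phi$, the number $\lambda^\Phi$ is the largest real part of an eigenvalue of (the complexification of) $A$, and $m^\Phi$ is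 the size of the largest Jordan block of the complexification of $A$ among all eigenvalues with real part $\lambda^\Phi$. -/

import Mathlib

open Set Filter Topology

noncomputable section

namespace LinFlow

variable {X : Type*} [NormedAddCommGroup X] [NormedSpace ℝ X]

/-- A flow (Mathlib's `Flow ℝ X`: jointly continuous, with the group property) is linear if all
its time-`t` maps are linear. -/
def IsLinearFlow (Φ : Flow ℝ X) : Prop :=
  ∀ t : ℝ, IsLinearMap ℝ (fun x => Φ t x)

/-- A stable flow: a linear flow all of whose orbits tend to the origin in forward time. -/
def IsStableFlow (Φ : Flow ℝ X) : Prop :=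
  IsLinearFlow Φ ∧ ∀ x : X, Tendsto (fun t : ℝ => Φ t x) atTop (𝓝 0)

/-- `A` generates `Φ`, that is, `Φ_t = e^{tA}` for every `t`. -/
def IsGenerator (Φ : Flow ℝ X) (A : X →L[ℝ] X) : Prop :=
  ∀ (t : ℝ) (x : X), Φ t x = NormedSpace.exp (t • A) x

/-- The admissible time changes: continuous functions `ρ : ℝ → ℝ` with `ρ(t) → ∞` as `t → ∞`.
They need be neither injective nor surjective. -/
def TimeChanges : Set (ℝ → ℝ) :=
  {ρ | Continuous ρ ∧ Tendsto ρ atTop atTop}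

/-- `x` is `δ`-distorting for `Φ`. One and the same `y` serves all time changes `ρ`. The upper
limit is taken in the extended reals, since it may be infinite. -/
def IsDistorting (Φ : Flow ℝ X) (δ : ℝ) (x : X) : Prop :=
  ∀ ε : ℝ, 0 < ε → ∃ y ∈ Metric.ball x ε \ {0}, ∀ ρ ∈ TimeChanges,
    (δ : EReal) ≤
      limsup (fun t : ℝ => ((‖Φ t x - Φ (ρ t) y‖ / ‖Φ (ρ t) y‖ : ℝ) : EReal)) atTop

/-- The set of distortion points of `Φ`. -/
def distortionSet (Φ : Flow ℝ X) : Set X :=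
  ⋃ δ ∈ Ioi (0 : ℝ), {x | IsDistorting Φ δ x}

open Classical in
/-- The forward Lyapunov exponent of `Φ` at `x`, with value `-∞` at `x = 0`. It is written as an
upper limit, so that it is defined without further ado; for `x ≠ 0` and a linear flow on a
finite-dimensional space this upper limit is a limit, and finite. -/
def lyapunovExponent (Φ : Flow ℝ X) (x : X) : EReal :=
  if x = 0 then ⊥ else limsup (fun t : ℝ => ((Real.log ‖Φ t x‖ / t : ℝ) : EReal)) atTop

/-- The Lyapunov space of `Φ` at `s`. -/
def lyapunovSpace (Φ : Flow ℝ X) (s : ℝ) : Set X :=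
  {x | lyapunovExponent Φ x ≤ (s : EReal)}

/-- The refined Lyapunov space `L_m(s)`: the points `x` with `Φ_t x / (e^{st} t^m) → 0`. -/
def refinedLyapunovSpace (Φ : Flow ℝ X) (m : ℕ) (s : ℝ) : Set X :=
  {x | Tendsto (fun t : ℝ => (Real.exp (s * t) * t ^ m)⁻¹ • Φ t x) atTop (𝓝 0)}

/-- The set of all values of the Lyapunov exponent at nonzero points. -/
def lyapunovExponents (Φ : Flow ℝ X) : Set ℝ :=
  {s | ∃ x : X, x ≠ 0 ∧ lyapunovExponent Φ x = (s : EReal)}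

/-- The largest Lyapunov exponent `λ` of `Φ`. -/
def topExponent (Φ : Flow ℝ X) : ℝ :=
  sSup (lyapunovExponents Φ)

/-- The number `m(s)`: the least `m` for which `L_m(s)` is the whole Lyapunov space at `s`. -/
def refinedIndex (Φ : Flow ℝ X) (s : ℝ) : ℕ :=
  sInf {m : ℕ | refinedLyapunovSpace Φ m s = lyapunovSpace Φ s}

/-- The number `m` of `Φ`, that is, `m(s)` at the largest Lyapunov exponent. -/
def topIndex (Φ : Flow ℝ X) : ℕ :=
  refinedIndex Φ (topExponent Φ)

/-- The complexification of a real operator. -/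
def complexify (A : X →L[ℝ] X) : Module.End ℂ (TensorProduct ℝ ℂ X) :=
  (A : X →ₗ[ℝ] X).baseChange ℂ

/-- `B` has a Jordan chain of length `k ≥ 1` at `z`: vectors `(B - z)^(k-1) v, …, (B - z) v, v`, of
which the first is an eigenvector for `z`. The greatest such `k` is the size of the largest
Jordan block of `B` for the eigenvalue `z`. -/
def HasJordanChain {V : Type*} [AddCommGroup V] [Module ℂ V] (B : Module.End ℂ V) (z : ℂ)
    (k : ℕ) : Prop :=
  1 ≤ k ∧ ∃ v : V, ((B - algebraMap ℂ (Module.End ℂ V) z) ^ (k - 1)) v ≠ 0 ∧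
    ((B - algebraMap ℂ (Module.End ℂ V) z) ^ k) v = 0

end LinFlow

end

/-! Generalized eigenfunctionals of the transposed generator turn orbits into exponential
polynomials: `f (Φ t x)` is `e^{zt}` times a polynomial in `t`
(`IsGenerator.apply_eq_exp_mul_orbitPoly`). They span all complex functionals. With `a` the largest
real part and `m` the largest block size there (`IsTopPair`), every orbit is therefore `O(e^{at}
t^(m-1))`, and it has either exactly this order or a smaller one (`IsTopPair.isBigO`,
`IsTopPair.isBigO_symm`). This dichotomy identifies `a` and `m` with the top exponent and the top
index. It also gives one inclusion: if the orbit of `x` has full order, then for `y` near `x` the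
difference of the orbits is a small fraction of `‖Φ t x‖`, so `ρ = id` rules out distortion
(`IsTopPair.not_isDistorting`).

For the other inclusion, let the orbit of `x` have smaller order, take a functional `ψ` heading a
chain of length `m`, and perturb `x` to `y` so that the polynomial of `y` under `ψ` has degree `n =
m - 1`, while that of `x` is zero or of degree `j < n`. In the nonzero case, a time change matching
the two must satisfy `e^{-a(ρ-t)} t^j ≥ const * ρ^n`; since `a < 0`, the lag `ρ - t` tends to
infinity. The lag being continuous, the phase difference keeps turning if the eigenvalue is not
real, and the quotient of leading terms returns to the closed left half plane; for a real eigenvalue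
the sign of the perturbation keeps it there. At such times the quotient of the two values cannot be
close to `1` (`not_eventually_norm_sub_le`). Since `‖Φ t y‖` and `‖ψ (Φ t y)‖` are eventually
comparable, this is distortion, with a `δ` independent of `x` (`IsTopPair.exists_isDistorting`). -/

noncomputable section

namespace LinFlow

/-! ### Generators of linear flows -/

section

/-- A norm-continuous one-parameter group in a real Banach algebra is differentiable at `0` and
hence is an exponential. -/
theorem exists_eq_exp_of_continuous {𝔸 : Type*} [NormedRing 𝔸] [NormedAlgebra ℝ 𝔸]
    [CompleteSpace 𝔸] (M : ℝ → 𝔸) (hc : Continuous M) (h0 : M 0 = 1)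
    (hadd : ∀ s t, M (s + t) = M s * M t) : ∃ A : 𝔸, ∀ t : ℝ, M t = NormedSpace.exp (t • A) := by
  set S : ℝ → 𝔸 := fun h => ∫ s in (0 : ℝ)..h, M s with hS
  have hint : ∀ a b : ℝ, IntervalIntegrable M MeasureTheory.volume a b :=
    fun a b => hc.intervalIntegrable a b
  have hdS : ∀ t, HasDerivAt S (M t) t := fun t =>
    intervalIntegral.integral_hasDerivAt_right (hint 0 t)
      hc.aestronglyMeasurable.stronglyMeasurableAtFilter hc.continuousAt
  -- Averages of `M` over short intervals are close to `1`, hence invertible. Dividing by one of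
  -- them expresses `M` through its primitive `S`, which is differentiable.
  have hlim : Tendsto (fun h : ℝ => h⁻¹ • S h) (𝓝[≠] 0) (𝓝 1) := by
    have := (hdS 0).tendsto_slope_zero
    simpa [hS, h0] using this
  have hunit : ∀ᶠ h in 𝓝[≠] (0 : ℝ), IsUnit (h⁻¹ • S h) :=
    hlim.eventually (Units.isOpen.mem_nhds isUnit_one)
  obtain ⟨h, hu, hne⟩ := (hunit.and eventually_mem_nhdsWithin).exists
  have hne : h ≠ 0 := hne
  have hmul : ∀ t, M t * S h = S (t + h) - S t := by
    intro t
    have h1 : M t * S h = ∫ s in (0 : ℝ)..h, M (s + t) := by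
      have := ((ContinuousLinearMap.mul ℝ 𝔸) (M t)).intervalIntegral_comp_comm (hint 0 h)
      rw [show M t * S h = (ContinuousLinearMap.mul ℝ 𝔸) (M t) (∫ s in (0 : ℝ)..h, M s) from rfl,
        ← this]
      refine intervalIntegral.integral_congr fun s _ => ?_
      simp only [ContinuousLinearMap.mul_apply']
      rw [add_comm s t, hadd]
    rw [h1, intervalIntegral.integral_comp_add_right, zero_add, add_comm h t, hS]
    exact (intervalIntegral.integral_interval_sub_left (hint _ _) (hint _ _)).symm
  obtain ⟨U, hU⟩ := hu
  have hM : ∀ t, M t = (S (t + h) - S t) * (h⁻¹ • (↑U⁻¹ : 𝔸)) := by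
    intro t
    rw [← hmul, mul_assoc, mul_smul_comm, ← smul_mul_assoc, ← hU, Units.mul_inv, mul_one]
  have hdM : ∃ A, HasDerivAt M A 0 := by
    have hd : HasDerivAt (fun t => (S (t + h) - S t) * (h⁻¹ • (↑U⁻¹ : 𝔸)))
        ((M (0 + h) - M 0) * (h⁻¹ • (↑U⁻¹ : 𝔸))) 0 :=
      (((hdS (0 + h)).comp_add_const 0 h).sub (hdS 0)).mul_const _
    exact ⟨_, by rwa [← funext hM] at hd⟩
  obtain ⟨A, hA⟩ := hdM
  have hdMt : ∀ t, HasDerivAt M (M t * A) t := by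
    intro t
    have h1 : HasDerivAt (fun s => M (s - t)) A t := by
      have : HasDerivAt M A (t - t) := by simpa using hA
      exact this.comp_sub_const t t
    have h2 := h1.const_mul (M t)
    refine h2.congr_of_eventuallyEq (Eventually.of_forall fun s => ?_)
    simp only
    rw [← hadd]; congr 1; ring
  refine ⟨A, fun t => ?_⟩
  have hexp : ∀ s : ℝ, HasDerivAt (fun s : ℝ => NormedSpace.exp ((t - s) • A))
      (-(A * NormedSpace.exp ((t - s) • A))) s := by
    intro s
    have := (hasDerivAt_exp_smul_const' (𝕂 := ℝ) A (t - s)).scomp s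
      ((hasDerivAt_id s).const_sub t)
    simpa [Function.comp_def] using this
  have hconst : ∀ s : ℝ, HasDerivAt (fun s => M s * NormedSpace.exp ((t - s) • A)) 0 s := by
    intro s
    have := (hdMt s).mul (hexp s)
    refine this.congr_deriv ?_
    rw [mul_neg, mul_assoc, add_neg_cancel]
  have := is_const_of_deriv_eq_zero (fun s => (hconst s).differentiableAt)
    (fun s => (hconst s).deriv) t 0
  simpa [h0] using this

variable {X : Type*} [NormedAddCommGroup X] [NormedSpace ℝ X]

/-- The time-`t` map of a linear flow as a continuous linear map. -/
def IsLinearFlow.toCLM {Φ : Flow ℝ X} (h : IsLinearFlow Φ) (t : ℝ) : X →L[ℝ] X :=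
  ⟨(h t).mk', Φ.continuous_toFun t⟩

@[simp]
theorem IsLinearFlow.toCLM_apply {Φ : Flow ℝ X} (h : IsLinearFlow Φ) (t : ℝ) (x : X) :
    h.toCLM t x = Φ t x := rfl

theorem IsLinearFlow.exists_isGenerator [FiniteDimensional ℝ X] {Φ : Flow ℝ X}
    (h : IsLinearFlow Φ) : ∃ A : X →L[ℝ] X, IsGenerator Φ A := by
  have : CompleteSpace X := FiniteDimensional.complete ℝ X
  obtain ⟨A, hA⟩ := exists_eq_exp_of_continuous h.toCLM
    (continuous_clm_apply.2 fun x => Φ.continuous continuous_id continuous_const)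
    (by ext x; simp) (fun s t => by ext x; simp [Φ.map_add])
  exact ⟨A, fun t x => by rw [← hA t, h.toCLM_apply]⟩

theorem IsGenerator.hasDerivAt [CompleteSpace X] {Φ : Flow ℝ X} {A : X →L[ℝ] X}
    (hA : IsGenerator Φ A) (x : X) (t : ℝ) : HasDerivAt (fun t => Φ t x) (A (Φ t x)) t := by
  have h := (hasDerivAt_exp_smul_const' (𝕂 := ℝ) A t).clm_apply (hasDerivAt_const t x)
  rw [funext fun t => hA t x, hA t x]
  simpa using h

end

/-! ### Jordan chains and orbits seen through generalized eigenfunctionals -/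

section

/-- The size of the kernel of the powers of `B - z` detects Jordan chains. -/
theorem hasJordanChain_iff_finrank_ker {V : Type*} [AddCommGroup V] [Module ℂ V]
    [FiniteDimensional ℂ V] (B : Module.End ℂ V) (z : ℂ) (k : ℕ) :
    HasJordanChain B z k ↔ 1 ≤ k ∧
      Module.finrank ℂ (LinearMap.ker ((B - algebraMap ℂ (Module.End ℂ V) z) ^ (k - 1))) ≠
        Module.finrank ℂ (LinearMap.ker ((B - algebraMap ℂ (Module.End ℂ V) z) ^ k)) := by
  refine and_congr_right fun hk => ?_
  set N := B - algebraMap ℂ (Module.End ℂ V) z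
  have hle : LinearMap.ker (N ^ (k - 1)) ≤ LinearMap.ker (N ^ k) :=
    N.iterateKer.monotone (Nat.sub_le k 1)
  constructor
  · rintro ⟨v, h1, h2⟩ h
    exact h1 (LinearMap.mem_ker.1
      ((Submodule.eq_of_le_of_finrank_eq hle h).symm ▸ LinearMap.mem_ker.2 h2))
  · intro h
    by_contra! hcon
    have hker : LinearMap.ker (N ^ (k - 1)) = LinearMap.ker (N ^ k) := by
      refine le_antisymm hle fun v hv => ?_
      by_contra hv'
      exact hcon v hv' hv
    rw [hker] at h
    exact h rfl

theorem HasJordanChain.mono {V : Type*} [AddCommGroup V] [Module ℂ V] {B : Module.End ℂ V} {z : ℂ}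
    {k l : ℕ} (h : HasJordanChain B z k) (hl : 1 ≤ l) (hlk : l ≤ k) : HasJordanChain B z l := by
  obtain ⟨_, v, h1, h2⟩ := h
  refine ⟨hl, ((B - algebraMap ℂ (Module.End ℂ V) z) ^ (k - l)) v, ?_, ?_⟩
  · rwa [← Module.End.mul_apply, ← pow_add, show l - 1 + (k - l) = k - 1 by omega]
  · rwa [← Module.End.mul_apply, ← pow_add, show l + (k - l) = k by omega]

/-- The kernels of the powers of `B - z` stop growing at the dimension. This bounds the chain
lengths, so that a longest chain exists. -/
theorem HasJordanChain.le_finrank {V : Type*} [AddCommGroup V] [Module ℂ V]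
    [FiniteDimensional ℂ V] {B : Module.End ℂ V} {z : ℂ} {k : ℕ} (h : HasJordanChain B z k) :
    k ≤ Module.finrank ℂ V := by
  obtain ⟨_, v, h1, h2⟩ := h
  by_contra! hk
  refine h1 ?_
  have hv : v ∈ B.genEigenspace z k := Module.End.mem_genEigenspace_nat.2 h2
  have := Module.End.genEigenspace_le_genEigenspace_finrank B z k hv
  exact Module.End.mem_genEigenspace_nat.1 (Module.End.genEigenspace B z |>.monotone
    (show ((Module.finrank ℂ V : ℕ) : ℕ∞) ≤ ((k - 1 : ℕ) : ℕ∞) by exact_mod_cast (by omega)) this)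

theorem hasJordanChain_one_iff {V : Type*} [AddCommGroup V] [Module ℂ V] {B : Module.End ℂ V}
    {z : ℂ} : HasJordanChain B z 1 ↔ B.HasEigenvalue z := by
  constructor
  · rintro ⟨_, v, h1, h2⟩
    refine Module.End.hasEigenvalue_of_hasEigenvector (x := v)
      (Module.End.hasEigenvector_iff.2 ⟨Module.End.mem_eigenspace_iff.2 ?_, by simpa using h1⟩)
    simpa [sub_eq_zero, Module.algebraMap_end_apply] using h2
  · intro h
    obtain ⟨v, hv⟩ := h.exists_hasEigenvector
    exact ⟨le_rfl, v, by simpa using hv.2,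
      by simp [Module.algebraMap_end_apply, hv.apply_eq_smul]⟩

variable {X : Type*} [NormedAddCommGroup X] [NormedSpace ℝ X]

/-- The transpose of a real operator, acting on the complex-valued functionals. -/
def transposeEnd (A : X →L[ℝ] X) : Module.End ℂ (X →ₗ[ℝ] ℂ) where
  toFun f := f ∘ₗ (A : X →ₗ[ℝ] X)
  map_add' _ _ := rfl
  map_smul' _ _ := rfl

@[simp]
theorem transposeEnd_apply (A : X →L[ℝ] X) (f : X →ₗ[ℝ] ℂ) (x : X) :
    transposeEnd A f x = f (A x) := rfl

/-- The operator `Aᵀ - z` on the complex-valued functionals. -/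
def shiftedTranspose (A : X →L[ℝ] X) (z : ℂ) : Module.End ℂ (X →ₗ[ℝ] ℂ) :=
  transposeEnd A - algebraMap ℂ (Module.End ℂ (X →ₗ[ℝ] ℂ)) z

theorem shiftedTranspose_apply (A : X →L[ℝ] X) (z : ℂ) (f : X →ₗ[ℝ] ℂ) (x : X) :
    shiftedTranspose A z f x = f (A x) - z * f x := by
  simp [shiftedTranspose, Module.algebraMap_end_apply]

/-- Complex functionals on `X` form the dual of the complexification, and there `shiftedTranspose A
z` becomes a dual map. A map and its dual have equal rank, so all powers have kernels of equal
dimension, and these dimensions determine the chain lengths. -/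
theorem hasJordanChain_transposeEnd_iff [FiniteDimensional ℝ X] (A : X →L[ℝ] X) (z : ℂ) (k : ℕ) :
    HasJordanChain (transposeEnd A) z k ↔ HasJordanChain (complexify A) z k := by
  set e := LinearMap.liftBaseChangeEquiv (R := ℝ) (M := X) (N := ℂ) ℂ
  set N := complexify A - algebraMap ℂ (Module.End ℂ (TensorProduct ℝ ℂ X)) z
  have hcomm : ∀ f, e (shiftedTranspose A z f) = N.dualMap (e f) := by
    intro f
    ext x
    simp [e, N, shiftedTranspose_apply, complexify, Module.algebraMap_end_apply]
  have hpow : ∀ (n : ℕ) f, e ((shiftedTranspose A z ^ n) f) = (N ^ n).dualMap (e f) := by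
    intro n
    induction n with
    | zero => intro f; ext; simp
    | succ n ih =>
      intro f
      rw [pow_succ', Module.End.mul_apply, hcomm, ih, pow_succ]
      rfl
  have hker : ∀ n : ℕ, Module.finrank ℂ (LinearMap.ker (shiftedTranspose A z ^ n)) =
      Module.finrank ℂ (LinearMap.ker (N ^ n)) := by
    intro n
    have h1 : LinearMap.ker (shiftedTranspose A z ^ n) =
        (LinearMap.ker (N ^ n).dualMap).comap (e : (X →ₗ[ℝ] ℂ) →ₗ[ℂ] _) := by
      ext f
      simp only [LinearMap.mem_ker, Submodule.mem_comap, LinearEquiv.coe_coe]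
      rw [← hpow n f, LinearEquiv.map_eq_zero_iff]
    have h2 : Module.finrank ℂ (LinearMap.ker (shiftedTranspose A z ^ n)) =
        Module.finrank ℂ (LinearMap.ker (N ^ n).dualMap) := by
      rw [h1]
      exact LinearEquiv.finrank_eq (e.ofSubmodule' _)
    have h3 := (N ^ n).dualMap.finrank_range_add_finrank_ker
    have h4 := (N ^ n).finrank_range_add_finrank_ker
    rw [LinearMap.finrank_range_dualMap_eq_finrank_range, Subspace.dual_finrank_eq] at h3
    omega
  rw [hasJordanChain_iff_finrank_ker, hasJordanChain_iff_finrank_ker]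
  change _ ∧ Module.finrank ℂ (LinearMap.ker (shiftedTranspose A z ^ (k - 1))) ≠
    Module.finrank ℂ (LinearMap.ker (shiftedTranspose A z ^ k)) ↔ _
  rw [hker, hker]

/-- The Taylor polynomial of order `k` that describes the action of a linear flow on a generalized
eigenfunctional. -/
def orbitPoly (A : X →L[ℝ] X) (z : ℂ) (k : ℕ) (f : X →ₗ[ℝ] ℂ) (x : X) : Polynomial ℂ :=
  ∑ i ∈ Finset.range k, Polynomial.monomial i ((i.factorial : ℂ)⁻¹ * (shiftedTranspose A z ^ i) f x)

theorem coeff_orbitPoly (A : X →L[ℝ] X) (z : ℂ) (k : ℕ) (f : X →ₗ[ℝ] ℂ) (x : X) (i : ℕ) :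
    (orbitPoly A z k f x).coeff i =
      if i < k then (i.factorial : ℂ)⁻¹ * (shiftedTranspose A z ^ i) f x else 0 := by
  simp [orbitPoly, Polynomial.finsetSum_coeff, Polynomial.coeff_monomial]

/-- Differentiating costs one application of `shiftedTranspose A z`; this drives the induction on
`k` for the orbit formula. -/
theorem derivative_orbitPoly (A : X →L[ℝ] X) (z : ℂ) (k : ℕ) (f : X →ₗ[ℝ] ℂ) (x : X) :
    (orbitPoly A z (k + 1) f x).derivative = orbitPoly A z k (shiftedTranspose A z f) x := by
  ext i
  rw [Polynomial.coeff_derivative, coeff_orbitPoly, coeff_orbitPoly]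
  simp only [add_lt_add_iff_right]
  split_ifs
  · rw [pow_succ, Module.End.mul_apply, Nat.factorial_succ]
    push_cast
    have : (i : ℂ) + 1 ≠ 0 := by exact_mod_cast i.succ_ne_zero
    field_simp
  · simp

/-- The orbits of a linear flow, seen through a generalized eigenfunctional. -/
theorem IsGenerator.apply_eq_exp_mul_orbitPoly [CompleteSpace X] [FiniteDimensional ℝ X]
    {Φ : Flow ℝ X} {A : X →L[ℝ] X} (hA : IsGenerator Φ A) (z : ℂ) (k : ℕ) :
    ∀ f : X →ₗ[ℝ] ℂ, (shiftedTranspose A z ^ k) f = 0 → ∀ (x : X) (t : ℝ),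
      f (Φ t x) = Complex.exp (z * t) * (orbitPoly A z k f x).eval (t : ℂ) := by
  induction k with
  | zero => intro f hf x t; simp at hf; simp [hf, orbitPoly]
  | succ k ih =>
    intro f hf x t
    have ih' := ih (shiftedTranspose A z f) (by rwa [pow_succ] at hf) x
    have hd : ∀ s : ℝ, HasDerivAt (fun s : ℝ => Complex.exp (-(z * s)) * f (Φ s x) -
        (orbitPoly A z (k + 1) f x).eval (s : ℂ)) 0 s := by
      intro s
      have h1 : HasDerivAt (fun s => f (Φ s x)) (f (A (Φ s x))) s :=
        (LinearMap.toContinuousLinearMap f).hasFDerivAt.comp_hasDerivAt s (hA.hasDerivAt x s)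
      have h2 : HasDerivAt (fun s : ℝ => Complex.exp (-(z * s)))
          (Complex.exp (-(z * s)) * (-(z * 1))) s :=
        ((((hasDerivAt_id (s : ℂ)).const_mul z).neg).cexp).comp_ofReal
      have h3 := ((orbitPoly A z (k + 1) f x).hasDerivAt (s : ℂ)).comp_ofReal
      refine ((h2.mul h1).sub h3).congr_deriv ?_
      rw [derivative_orbitPoly]
      have h4 := ih' s
      rw [shiftedTranspose_apply] at h4
      have h5 : Complex.exp (-(z * s)) * Complex.exp (z * s) = 1 := by
        rw [← Complex.exp_add]; simp
      linear_combination Complex.exp (-(z * s)) * h4 +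
        (orbitPoly A z k (shiftedTranspose A z f) x).eval (s : ℂ) * h5
    have hconst := is_const_of_deriv_eq_zero (fun s => (hd s).differentiableAt)
      (fun s => (hd s).deriv) t 0
    have h0 : (orbitPoly A z (k + 1) f x).eval 0 = f x := by
      rw [← Polynomial.coeff_zero_eq_eval_zero, coeff_orbitPoly]; simp
    simp only [Complex.ofReal_zero, mul_zero, neg_zero, Complex.exp_zero, one_mul,
      Flow.map_zero_apply, h0, sub_self] at hconst
    rw [← sub_eq_zero.1 hconst, ← mul_assoc, ← Complex.exp_add]
    simp

end

/-! ### Growth rates of orbits -/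

section

theorem tendsto_eval_div_pow (p : Polynomial ℂ) {n : ℕ} (h : p.natDegree ≤ n) :
    Tendsto (fun t : ℝ => p.eval (t : ℂ) / (t : ℂ) ^ n) atTop (𝓝 (p.coeff n)) := by
  have h1 : Tendsto (fun t : ℝ => ∑ i ∈ Finset.range n, p.coeff i * ((t : ℂ) ^ i / (t : ℂ) ^ n))
      atTop (𝓝 (∑ i ∈ Finset.range n, p.coeff i * 0)) := by
    refine tendsto_finsetSum _ fun i hi => Tendsto.const_mul _ ?_
    have h2 : Tendsto (fun t : ℝ => t ^ i / t ^ n) atTop (𝓝 0) :=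
      tendsto_pow_div_pow_atTop_zero (Finset.mem_range.1 hi)
    have h3 := (Complex.continuous_ofReal.tendsto 0).comp h2
    simpa [Function.comp_def] using h3
  have h4 := h1.add_const (p.coeff n)
  simp only [mul_zero, Finset.sum_const_zero, zero_add] at h4
  refine h4.congr' ?_
  filter_upwards [eventually_gt_atTop 0] with t ht
  have ht' : (t : ℂ) ^ n ≠ 0 := pow_ne_zero _ (by exact_mod_cast ht.ne')
  rw [Polynomial.eval_eq_sum_range' (Nat.lt_succ_of_le h), Finset.sum_range_succ, add_div,
    mul_div_cancel_right₀ _ ht', Finset.sum_div]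
  simp [mul_div_assoc]

/-- The comparison function `e^{at} t^n`. -/
def expPow (a : ℝ) (n : ℕ) (t : ℝ) : ℝ := Real.exp (a * t) * t ^ n

theorem expPow_pos (a : ℝ) (n : ℕ) {t : ℝ} (ht : 0 < t) : 0 < expPow a n t := by
  unfold expPow; positivity

theorem tendsto_exp_mul_eval_div_expPow (z : ℂ) (p : Polynomial ℂ) {n : ℕ}
    (h : p.natDegree ≤ n) :
    Tendsto (fun t : ℝ => ‖Complex.exp (z * t) * p.eval (t : ℂ)‖ / expPow z.re n t) atTop
      (𝓝 ‖p.coeff n‖) := by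
  refine (tendsto_eval_div_pow p h).norm.congr' ?_
  filter_upwards [eventually_gt_atTop 0] with t ht
  rw [norm_mul, Complex.norm_exp, expPow, norm_div, norm_pow, Complex.norm_real,
    Real.norm_of_nonneg ht.le]
  have : (z * (t : ℂ)).re = z.re * t := by simp
  rw [this, mul_div_mul_left _ _ (Real.exp_pos _).ne']

theorem expPow_isLittleO {a b : ℝ} (hab : a < b) (n k : ℕ) :
    expPow a n =o[atTop] expPow b k := by
  have h1 : (fun t : ℝ => Real.exp (a * t) * t ^ n) =o[atTop] fun t => Real.exp (b * t) * 1 := by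
    have h2 : (fun t : ℝ => t ^ n) =o[atTop] fun t => Real.exp ((b - a) * t) :=
      isLittleO_pow_exp_pos_mul_atTop n (sub_pos.2 hab)
    refine ((Asymptotics.isBigO_refl (fun t : ℝ => Real.exp (a * t))
      atTop).mul_isLittleO h2).congr_right ?_
    intro t
    rw [← Real.exp_add]; ring_nf
  refine h1.trans_isBigO ((Asymptotics.isBigO_refl _ _).mul ?_)
  refine Asymptotics.IsBigO.of_bound 1 ?_
  filter_upwards [eventually_ge_atTop 1] with t ht
  have := one_le_pow₀ ht (n := k)
  rw [norm_one, Real.norm_of_nonneg (by positivity)]; linarith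

theorem expPow_isLittleO_of_lt (a : ℝ) {n k : ℕ} (h : n < k) :
    expPow a n =o[atTop] expPow a k :=
  (Asymptotics.isBigO_refl _ _).mul_isLittleO (Asymptotics.isLittleO_pow_pow_atTop_of_lt h)

theorem expPow_isBigO_of_le (a : ℝ) {n k : ℕ} (h : n ≤ k) :
    expPow a n =O[atTop] expPow a k := by
  rcases h.eq_or_lt with rfl | h
  · exact Asymptotics.isBigO_refl _ _
  · exact (expPow_isLittleO_of_lt a h).isBigO

variable {X : Type*} [NormedAddCommGroup X] [NormedSpace ℝ X]

theorem mem_refinedLyapunovSpace_iff {Φ : Flow ℝ X} {n : ℕ} {s : ℝ} {x : X} :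
    x ∈ refinedLyapunovSpace Φ n s ↔ (fun t => Φ t x) =o[atTop] expPow s n := by
  rw [← Asymptotics.isLittleO_norm_left, Asymptotics.isLittleO_iff_tendsto']
  · rw [refinedLyapunovSpace, mem_ofPred_eq, tendsto_zero_iff_norm_tendsto_zero]
    refine tendsto_congr' ?_
    filter_upwards [eventually_gt_atTop 0] with t ht
    have := expPow_pos s n ht
    rw [norm_smul, norm_inv, div_eq_inv_mul]
    change ‖expPow s n t‖⁻¹ * _ = _
    rw [Real.norm_of_nonneg this.le]
  · filter_upwards [eventually_gt_atTop 0] with t ht h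
    exact absurd h (expPow_pos s n ht).ne'

/-- The refined Lyapunov space of a linear flow, as a linear subspace. -/
def IsLinearFlow.refinedLyapunovSubmodule {Φ : Flow ℝ X} (h : IsLinearFlow Φ) (n : ℕ) (s : ℝ) :
    Submodule ℝ X where
  carrier := refinedLyapunovSpace Φ n s
  zero_mem' := by
    rw [mem_refinedLyapunovSpace_iff]
    simp only [(h _).map_zero]
    exact Asymptotics.isLittleO_zero _ _
  add_mem' := by
    intro x y hx hy
    rw [mem_refinedLyapunovSpace_iff] at *
    simp only [(h _).map_add]
    exact hx.add hy
  smul_mem' := by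
    intro c x hx
    rw [mem_refinedLyapunovSpace_iff] at *
    simp only [(h _).map_smul]
    exact hx.const_smul_left c

theorem IsLinearFlow.image_refinedLyapunovSpace {Φ : Flow ℝ X} (h : IsLinearFlow Φ) (n : ℕ)
    (s : ℝ) (t : ℝ) : (fun x => Φ t x) '' refinedLyapunovSpace Φ n s =
      refinedLyapunovSpace Φ n s := by
  have key : ∀ (t : ℝ) (x : X), x ∈ refinedLyapunovSpace Φ n s →
      Φ t x ∈ refinedLyapunovSpace Φ n s := by
    intro t x hx
    rw [mem_refinedLyapunovSpace_iff] at *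
    have : (fun r => Φ r (Φ t x)) = fun r => h.toCLM t (Φ r x) := by
      ext r; rw [h.toCLM_apply, ← Φ.map_add, ← Φ.map_add, add_comm]
    rw [this]
    exact ((h.toCLM t).isBigO_comp _ _).trans_isLittleO hx
  refine Subset.antisymm (image_subset_iff.2 (key t)) fun x hx => ⟨Φ (-t) x, key _ x hx, ?_⟩
  simp [← Φ.map_add]

theorem isBigO_of_forall_functional [FiniteDimensional ℝ X] {u : ℝ → X} {g : ℝ → ℝ}
    (h : ∀ f : X →ₗ[ℝ] ℂ, (fun t => f (u t)) =O[atTop] g) : u =O[atTop] g := by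
  let b := Module.finBasis ℝ X
  have h1 : u = fun t => ∑ i, b.coord i (u t) • b i := by
    ext t; simp [b.sum_repr]
  suffices h6 : ∀ i, (fun t => b.coord i (u t) • b i) =O[atTop] g by
    rw [h1]
    exact Asymptotics.IsBigO.fun_sum fun i _ => h6 i
  intro i
  have h2 := h (Complex.ofRealCLM.toLinearMap ∘ₗ b.coord i)
  have h3 : (fun t => b.coord i (u t)) =O[atTop] g := by
    have h5 : (fun t => b.coord i (u t)) =O[atTop] fun t => ((b.coord i (u t) : ℝ) : ℂ) :=
      Asymptotics.IsBigO.of_bound 1 (Eventually.of_forall fun t => by simp)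
    exact h5.trans h2
  have h4 : (fun t => g t • b i) =O[atTop] g :=
    Asymptotics.IsBigO.of_bound ‖b i‖ (Eventually.of_forall fun t => by
      rw [norm_smul, mul_comm])
  exact (h3.smul (Asymptotics.isBigO_refl (fun _ => b i) atTop)).trans h4

theorem isLittleO_of_forall_functional [FiniteDimensional ℝ X] {u : ℝ → X} {g : ℝ → ℝ}
    (h : ∀ f : X →ₗ[ℝ] ℂ, (fun t => f (u t)) =o[atTop] g) : u =o[atTop] g := by
  let b := Module.finBasis ℝ X
  have h1 : u = fun t => ∑ i, b.coord i (u t) • b i := by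
    ext t; simp [b.sum_repr]
  suffices h6 : ∀ i, (fun t => b.coord i (u t) • b i) =o[atTop] g by
    rw [h1]
    exact Asymptotics.IsLittleO.fun_sum fun i _ => h6 i
  intro i
  have h2 := h (Complex.ofRealCLM.toLinearMap ∘ₗ b.coord i)
  have h3 : (fun t => b.coord i (u t)) =o[atTop] g := by
    have h5 : (fun t => b.coord i (u t)) =O[atTop] fun t => ((b.coord i (u t) : ℝ) : ℂ) :=
      Asymptotics.IsBigO.of_bound 1 (Eventually.of_forall fun t => by simp)
    exact h5.trans_isLittleO h2
  have h4 : (fun t => g t • b i) =O[atTop] g :=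
    Asymptotics.IsBigO.of_bound ‖b i‖ (Eventually.of_forall fun t => by
      rw [norm_smul, mul_comm])
  exact (h3.smul_isBigO (Asymptotics.isBigO_refl (fun _ => b i) atTop)).trans_isBigO h4

theorem iSup_maxGenEigenspace_transposeEnd [FiniteDimensional ℝ X] (A : X →L[ℝ] X) :
    ⨆ z, (transposeEnd A).maxGenEigenspace z = ⊤ :=
  Module.End.iSup_maxGenEigenspace_eq_top _

theorem mem_maxGenEigenspace_transposeEnd {A : X →L[ℝ] X} {z : ℂ} {f : X →ₗ[ℝ] ℂ} :
    f ∈ (transposeEnd A).maxGenEigenspace z ↔ ∃ k : ℕ, (shiftedTranspose A z ^ k) f = 0 :=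
  Module.End.mem_maxGenEigenspace _ _ _

/-- `a` is the largest real part of an eigenvalue of the transpose of `A`, and `m` is the size of
the largest Jordan block of the transpose at that real part. -/
structure IsTopPair (A : X →L[ℝ] X) (a : ℝ) (m : ℕ) : Prop where
  eigenvalue : IsGreatest {b : ℝ | ∃ z : ℂ, (transposeEnd A).HasEigenvalue z ∧ z.re = b} a
  chain : IsGreatest {k : ℕ | ∃ z : ℂ, z.re = a ∧ HasJordanChain (transposeEnd A) z k} m

theorem exists_isTopPair [FiniteDimensional ℝ X] [Nontrivial X] (A : X →L[ℝ] X) :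
    ∃ a m, IsTopPair A a m := by
  have hnt : Nontrivial (X →ₗ[ℝ] ℂ) := by
    obtain ⟨x, hx⟩ := exists_ne (0 : X)
    obtain ⟨f, hf⟩ := SeparatingDual.exists_ne_zero (R := ℝ) hx
    refine ⟨Complex.ofRealCLM.toLinearMap ∘ₗ f.toLinearMap, 0, fun h => hf ?_⟩
    simpa using LinearMap.congr_fun h x
  obtain ⟨z₀, hz₀⟩ := Module.End.exists_eigenvalue (transposeEnd A)
  have hfin : {z : ℂ | (transposeEnd A).HasEigenvalue z}.Finite :=
    Module.End.finite_hasEigenvalue _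
  obtain ⟨z₁, hz₁, hmax⟩ := Set.exists_max_image _ Complex.re hfin ⟨z₀, hz₀⟩
  have hne : {k : ℕ | ∃ z : ℂ, z.re = z₁.re ∧ HasJordanChain (transposeEnd A) z k}.Nonempty :=
    ⟨1, z₁, rfl, hasJordanChain_one_iff.2 hz₁⟩
  have hbdd : BddAbove {k : ℕ | ∃ z : ℂ, z.re = z₁.re ∧ HasJordanChain (transposeEnd A) z k} :=
    ⟨_, fun k ⟨z, _, hk⟩ => hk.le_finrank⟩
  refine ⟨z₁.re, sSup {k : ℕ | ∃ z : ℂ, z.re = z₁.re ∧ HasJordanChain (transposeEnd A) z k},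
    ⟨⟨z₁, hz₁, rfl⟩, ?_⟩, Nat.sSup_mem hne hbdd, fun k hk => le_csSup hbdd hk⟩
  rintro b ⟨z, hz, rfl⟩
  exact hmax z hz

theorem natDegree_orbitPoly_le (A : X →L[ℝ] X) (z : ℂ) (k : ℕ) (f : X →ₗ[ℝ] ℂ) (x : X) :
    (orbitPoly A z k f x).natDegree ≤ k - 1 := by
  refine Polynomial.natDegree_le_iff_coeff_eq_zero.2 fun i hi => ?_
  rw [coeff_orbitPoly, if_neg (by omega)]

namespace IsTopPair

variable {A : X →L[ℝ] X} {a : ℝ} {m : ℕ}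

theorem one_le (h : IsTopPair A a m) : 1 ≤ m := by
  obtain ⟨⟨z, hz, hk⟩, _⟩ := h.chain
  exact hk.1

/-- The least power that kills a nonzero `f` is the length of a Jordan chain. Such a chain makes `z`
an eigenvalue, so its real part is exactly `a` and `m` bounds the length. -/
theorem shiftedTranspose_pow_eq_zero (h : IsTopPair A a m) {z : ℂ} (hz : a ≤ z.re)
    {f : X →ₗ[ℝ] ℂ} (hf : f ∈ (transposeEnd A).maxGenEigenspace z) :
    (shiftedTranspose A z ^ m) f = 0 := by
  classical
  have hex := mem_maxGenEigenspace_transposeEnd.1 hf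
  by_cases hf0 : f = 0
  · simp [hf0]
  have hpos : 1 ≤ Nat.find hex := by
    by_contra! h0
    have := Nat.find_spec hex
    rw [Nat.lt_one_iff.1 h0] at this
    exact hf0 (by simpa using this)
  have hchain : HasJordanChain (transposeEnd A) z (Nat.find hex) :=
    ⟨hpos, f, Nat.find_min hex (by omega), Nat.find_spec hex⟩
  have hev := hasJordanChain_one_iff.1 (hchain.mono le_rfl hpos)
  have hre : z.re = a := le_antisymm (h.eigenvalue.2 ⟨z, hev, rfl⟩) hz
  have hle : Nat.find hex ≤ m := h.chain.2 ⟨z, hre, hchain⟩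
  rw [← Nat.sub_add_cancel hle, pow_add, Module.End.mul_apply, Nat.find_spec hex, map_zero]

variable [FiniteDimensional ℝ X] {Φ : Flow ℝ X}

/-- Every generalized eigenfunctional grows along an orbit like a constant multiple of the
comparison function, up to terms of lower order. -/
theorem exists_tendsto_norm_div (h : IsTopPair A a m) (hA : IsGenerator Φ A) {z : ℂ}
    {f : X →ₗ[ℝ] ℂ} (hf : f ∈ (transposeEnd A).maxGenEigenspace z) (x : X) :
    ∃ c : ℝ, Tendsto (fun t => ‖f (Φ t x)‖ / expPow a (m - 1) t) atTop (𝓝 c) := by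
  have : CompleteSpace X := FiniteDimensional.complete ℝ X
  -- Below the top real part the exponential gap beats any polynomial, so the order `k` is
  -- irrelevant and the limit is `0`.
  rcases lt_or_ge z.re a with hz | hz
  · obtain ⟨k, hk⟩ := mem_maxGenEigenspace_transposeEnd.1 hf
    refine ⟨0, ?_⟩
    have h1 := tendsto_exp_mul_eval_div_expPow z _ (natDegree_orbitPoly_le A z k f x)
    have h2 := (expPow_isLittleO hz (k - 1) (m - 1)).tendsto_div_nhds_zero
    have h3 := h1.mul h2
    rw [mul_zero] at h3
    refine h3.congr' ?_
    filter_upwards [eventually_gt_atTop 0] with t ht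
    rw [hA.apply_eq_exp_mul_orbitPoly z k f hk, div_mul_div_cancel₀ (expPow_pos _ _ ht).ne']
  · have hk := h.shiftedTranspose_pow_eq_zero hz hf
    by_cases hf0 : f = 0
    · exact ⟨0, by simp [hf0]⟩
    have hre : z.re = a := by
      have hev : (transposeEnd A).HasEigenvalue z := by
        refine Module.End.hasEigenvalue_of_hasGenEigenvalue (k := m) ?_
        rw [Module.End.hasGenEigenvalue_iff]
        intro hbot
        exact hf0 ((Submodule.mem_bot ℂ).1 (hbot ▸ Module.End.mem_genEigenspace_nat.2 hk))
      exact le_antisymm (h.eigenvalue.2 ⟨z, hev, rfl⟩) hz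
    have h1 := tendsto_exp_mul_eval_div_expPow z _ (natDegree_orbitPoly_le A z m f x)
    simp only [← hA.apply_eq_exp_mul_orbitPoly z m f hk x, hre] at h1
    exact ⟨_, h1⟩

/-- The bound is linear in the functional, so generalized eigenfunctionals suffice, and for these
the quotient converges. -/
theorem isBigO (h : IsTopPair A a m) (hA : IsGenerator Φ A) (x : X) :
    (fun t => Φ t x) =O[atTop] expPow a (m - 1) := by
  refine isBigO_of_forall_functional fun f => ?_
  have hf : f ∈ ⨆ z, (transposeEnd A).maxGenEigenspace z := by
    rw [iSup_maxGenEigenspace_transposeEnd]; trivial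
  refine Submodule.iSup_induction _ (motive := fun f : X →ₗ[ℝ] ℂ =>
    (fun t => f (Φ t x)) =O[atTop] expPow a (m - 1)) hf ?_ ?_ ?_
  · intro z f hf
    obtain ⟨c, hc⟩ := h.exists_tendsto_norm_div hA hf x
    rw [← Asymptotics.isBigO_norm_left]
    exact Asymptotics.isBigO_of_div_tendsto_nhds (by
      filter_upwards [eventually_gt_atTop 0] with t ht h
      exact absurd h (expPow_pos _ _ ht).ne') c hc
  · exact Asymptotics.isBigO_zero _ _
  · intro f g hf hg
    exact hf.add hg

/-- The orbits outside of the refined Lyapunov space have the maximal order of growth. -/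
theorem isBigO_symm (h : IsTopPair A a m) (hA : IsGenerator Φ A) {x : X}
    (hx : x ∉ refinedLyapunovSpace Φ (m - 1) a) :
    expPow a (m - 1) =O[atTop] (fun t => Φ t x) := by
  by_contra hcon
  refine hx (mem_refinedLyapunovSpace_iff.2 (isLittleO_of_forall_functional fun f => ?_))
  have hf : f ∈ ⨆ z, (transposeEnd A).maxGenEigenspace z := by
    rw [iSup_maxGenEigenspace_transposeEnd]; trivial
  refine Submodule.iSup_induction _ (motive := fun f : X →ₗ[ℝ] ℂ =>
    (fun t => f (Φ t x)) =o[atTop] expPow a (m - 1)) hf ?_ ?_ ?_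
  · intro z f hf
    obtain ⟨c, hc⟩ := h.exists_tendsto_norm_div hA hf x
    have hev : ∀ᶠ t in atTop, expPow a (m - 1) t ≠ 0 := by
      filter_upwards [eventually_gt_atTop 0] with t ht using (expPow_pos _ _ ht).ne'
    by_cases hc0 : c = 0
    · rw [← Asymptotics.isLittleO_norm_left, Asymptotics.isLittleO_iff_tendsto']
      · rwa [hc0] at hc
      · filter_upwards [hev] with t ht h using absurd h ht
    -- A single nonzero limit would already bound the orbit from below, against `hcon`; hence all
    -- the limits vanish.
    · refine absurd ?_ hcon
      have hinv := hc.inv₀ hc0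
      have h1 : expPow a (m - 1) =O[atTop] fun t => ‖f (Φ t x)‖ := by
        refine Asymptotics.isBigO_of_div_tendsto_nhds ?_ c⁻¹ (hinv.congr fun t => inv_div _ _)
        filter_upwards [hc.eventually_ne hc0] with t ht h
        exact absurd (by rw [h, zero_div]) ht
      exact (Asymptotics.isBigO_norm_right.1 h1).trans
        ((LinearMap.toContinuousLinearMap f).isBigO_comp _ _)
  · exact Asymptotics.isLittleO_zero _ _
  · intro f g hf hg
    exact hf.add hg

/-- By linearity only the finitely many orbits of a basis matter, so one constant and one threshold
time serve all `x`. -/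
theorem exists_uniform_bound (h : IsTopPair A a m) (hΦ : IsLinearFlow Φ) (hA : IsGenerator Φ A) :
    ∃ C : ℝ, 0 < C ∧ ∀ᶠ t in atTop, ∀ x, ‖Φ t x‖ ≤ C * ‖x‖ * expPow a (m - 1) t := by
  let b := Module.finBasis ℝ X
  have h1 : ∀ i, ∃ c : ℝ, 0 < c ∧ ∀ᶠ t in atTop, ‖Φ t (b i)‖ ≤ c * ‖expPow a (m - 1) t‖ :=
    fun i => by
      obtain ⟨c, hc, hb⟩ := (h.isBigO hA (b i)).exists_pos
      exact ⟨c, hc, hb.bound⟩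
  choose c hc hb using h1
  let φ : Fin (Module.finrank ℝ X) → (X →L[ℝ] ℝ) := fun i =>
    LinearMap.toContinuousLinearMap (b.coord i)
  refine ⟨∑ i, ‖φ i‖ * c i + 1, ?_, ?_⟩
  · have : 0 ≤ ∑ i, ‖φ i‖ * c i :=
      Finset.sum_nonneg fun i _ => mul_nonneg (norm_nonneg _) (hc i).le
    linarith
  filter_upwards [eventually_all.2 hb, eventually_gt_atTop 0] with t ht ht0 x
  have hg := expPow_pos a (m - 1) ht0
  have h2 : Φ t x = ∑ i, φ i x • Φ t (b i) := by
    conv_lhs => rw [← b.sum_repr x, ← hΦ.toCLM_apply, map_sum]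
    simp [φ]
  calc ‖Φ t x‖ ≤ ∑ i, ‖φ i x • Φ t (b i)‖ := by rw [h2]; exact norm_sum_le _ _
    _ ≤ ∑ i, ‖φ i‖ * ‖x‖ * (c i * expPow a (m - 1) t) := by
      refine Finset.sum_le_sum fun i _ => ?_
      rw [norm_smul]
      have := ht i
      rw [Real.norm_of_nonneg hg.le] at this
      exact mul_le_mul ((φ i).le_opNorm x) this (norm_nonneg _) (by positivity)
    _ = (∑ i, ‖φ i‖ * c i) * ‖x‖ * expPow a (m - 1) t := by
      rw [Finset.sum_mul, Finset.sum_mul]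
      exact Finset.sum_congr rfl fun i _ => by ring
    _ ≤ _ := by
      gcongr
      linarith

/-- A functional that sees the leading term of the orbits. -/
theorem exists_leading_functional (h : IsTopPair A a m) (hA : IsGenerator Φ A) :
    ∃ (ψ : X →L[ℝ] ℂ) (z : ℂ) (p : X → Polynomial ℂ) (c : X →ₗ[ℝ] ℂ), z.re = a ∧ c ≠ 0 ∧
      (∀ x, (p x).natDegree ≤ m - 1) ∧ (∀ x, (p x).coeff (m - 1) = c x) ∧
      ∀ x (t : ℝ), ψ (Φ t x) = Complex.exp (z * t) * (p x).eval (t : ℂ) := by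
  have : CompleteSpace X := FiniteDimensional.complete ℝ X
  obtain ⟨z, hz, hm, f, hf1, hf2⟩ := h.chain.1
  refine ⟨LinearMap.toContinuousLinearMap f, z, orbitPoly A z m f,
    (((m - 1).factorial : ℂ)⁻¹) • (shiftedTranspose A z ^ (m - 1)) f, hz, ?_,
    natDegree_orbitPoly_le A z m f, fun x => ?_,
    fun x t => hA.apply_eq_exp_mul_orbitPoly z m f hf2 x t⟩
  · exact smul_ne_zero (inv_ne_zero (by exact_mod_cast (m - 1).factorial_ne_zero)) hf1
  · rw [coeff_orbitPoly, if_pos (by omega)]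
    rfl

end IsTopPair

end

/-! ### Time changes and distortion -/

section

/-- If `ρ(t)` compensates a polynomial factor by an exponential one, then the lag `ρ(t) - t` tends
to infinity. -/
theorem tendsto_sub_atTop_of_pow_le {ρ : ℝ → ℝ} (hρ : Tendsto ρ atTop atTop) {b c : ℝ} (hb : 0 < b)
    (hc : 0 < c) (k : ℕ)
    (h : ∀ᶠ t in atTop, c * ρ t ^ (k + 1) ≤ Real.exp (b * (ρ t - t)) * t ^ k) :
    Tendsto (fun t => ρ t - t) atTop atTop := by
  refine tendsto_atTop.2 fun K => ?_
  have h1 : Tendsto (fun t : ℝ => Real.exp (-(b / 2) * t) * t ^ k) atTop (𝓝 0) := by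
    refine (isLittleO_pow_exp_pos_mul_atTop k (half_pos hb)).tendsto_div_nhds_zero.congr fun t => ?_
    rw [neg_mul, Real.exp_neg, div_eq_inv_mul]
  filter_upwards [h, h1.eventually (gt_mem_nhds hc), hρ.eventually_ge_atTop 1,
    eventually_gt_atTop 0, eventually_ge_atTop (Real.exp (b * K) * 2 ^ (k + 1) / c)]
    with t ht hlt hρ1 ht0 htK
  -- If `ρ t ≥ t / 2`, the surplus power of `ρ t` leaves a factor of order `t` for the exponential
  -- to compensate. Otherwise the right side is at most `e^{-bt/2} t^k < c`, while the left side is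
  -- at least `c`.
  rcases le_or_gt (t / 2) (ρ t) with hcase | hcase
  · have h3 : c * (t / 2) ^ (k + 1) ≤ Real.exp (b * (ρ t - t)) * t ^ k := by
      refine le_trans ?_ ht
      gcongr
    have h4 : c * t / 2 ^ (k + 1) ≤ Real.exp (b * (ρ t - t)) := by
      rw [div_pow, pow_succ t] at h3
      have h5 : 0 < t ^ k := by positivity
      refine le_of_mul_le_mul_right (le_trans (le_of_eq ?_) h3) h5
      ring
    have h5 : Real.exp (b * K) ≤ c * t / 2 ^ (k + 1) := by
      rw [div_le_iff₀ hc] at htK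
      rw [le_div_iff₀ (by positivity)]
      linarith
    exact le_of_mul_le_mul_left (Real.exp_le_exp.1 (h5.trans h4)) hb
  · exfalso
    have h3 : c ≤ c * ρ t ^ (k + 1) := le_mul_of_one_le_right hc.le (one_le_pow₀ hρ1)
    have h4 : Real.exp (b * (ρ t - t)) * t ^ k ≤ Real.exp (-(b / 2) * t) * t ^ k := by
      refine mul_le_mul_of_nonneg_right (Real.exp_le_exp.2 ?_) (by positivity)
      nlinarith
    linarith

/-- A rotation by a continuous angle that tends to infinity brings any complex number into the left
half plane again and again. -/
theorem frequently_re_exp_mul_nonpos {d : ℝ → ℝ} (hd : Continuous d) (hlim : Tendsto d atTop atTop)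
    (ω : ℝ) {u : ℂ} (hu : u.re ≤ 0) :
    ∃ᶠ t in atTop, (Complex.exp (-(ω * d t * Complex.I)) * u).re ≤ 0 := by
  refine frequently_atTop.2 fun T => ?_
  by_cases hω : ω = 0
  · exact ⟨T, le_rfl, by simpa [hω] using hu⟩
  by_cases hT : (Complex.exp (-(ω * d T * Complex.I)) * u).re ≤ 0
  · exact ⟨T, le_rfl, hT⟩
  -- A further lag of `π / |ω|`, attained by the intermediate value theorem, is a half turn and
  -- reverses the sign of the real part.
  obtain ⟨T', hT', hd'⟩ := ((eventually_ge_atTop T).and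
    (hlim.eventually_ge_atTop (d T + Real.pi / |ω|))).exists
  obtain ⟨t, ht, hdt⟩ := intermediate_value_Icc hT' hd.continuousOn
    (show d T + Real.pi / |ω| ∈ Icc (d T) (d T') from
      ⟨le_add_of_nonneg_right (by positivity), hd'⟩)
  refine ⟨t, ht.1, ?_⟩
  have hexp : Complex.exp (-(ω * d t * Complex.I)) = -Complex.exp (-(ω * d T * Complex.I)) := by
    rw [hdt]
    have habs : ((|ω| : ℝ) : ℂ) ≠ 0 := by exact_mod_cast (abs_pos.2 hω).ne'
    rcases abs_choice ω with h | h
    · rw [h] at habs ⊢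
      rw [← Complex.exp_sub_pi_mul_I]
      congr 1
      push_cast
      field_simp
      ring
    · have : (ω : ℂ) ≠ 0 := by exact_mod_cast hω
      rw [h, ← Complex.exp_add_pi_mul_I]
      congr 1
      push_cast
      field_simp
      ring
  rw [hexp, neg_mul, Complex.neg_re]
  linarith [not_le.1 hT]

theorem eventually_eval_ne_zero {Q : Polynomial ℂ} (hQ : Q ≠ 0) :
    ∀ᶠ t : ℝ in atTop, Q.eval (t : ℂ) ≠ 0 := by
  have h := (tendsto_eval_div_pow Q le_rfl).eventually_ne (Polynomial.leadingCoeff_ne_zero.2 hQ)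
  filter_upwards [h] with t ht h0
  simp [h0] at ht

/-- Two exponential polynomials with the same decaying exponential factor, whose degrees differ and
whose leading coefficients do not point into the same half plane, cannot be matched by a time
change. -/
theorem not_eventually_norm_sub_le {z : ℂ} (hz : z.re < 0) {P Q : Polynomial ℂ} (hQ : Q ≠ 0)
    (hdeg : P ≠ 0 → P.natDegree < Q.natDegree)
    (hlead : (P.leadingCoeff / Q.leadingCoeff).re ≤ 0) {ρ : ℝ → ℝ} (hρ : ρ ∈ TimeChanges) :
    ¬ ∀ᶠ t : ℝ in atTop, ‖Complex.exp (z * t) * P.eval (t : ℂ) -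
        Complex.exp (z * ρ t) * Q.eval (ρ t : ℂ)‖ ≤
      1 / 2 * ‖Complex.exp (z * ρ t) * Q.eval (ρ t : ℂ)‖ := by
  intro hev
  obtain ⟨hρc, hρlim⟩ := hρ
  have hQne : ∀ᶠ t : ℝ in atTop, Q.eval (ρ t : ℂ) ≠ 0 :=
    hρlim.eventually (eventually_eval_ne_zero hQ)
  by_cases hP : P = 0
  · obtain ⟨t, h1, h2⟩ := (hev.and hQne).exists
    have h3 : 0 < ‖Complex.exp (z * ρ t) * Q.eval (ρ t : ℂ)‖ :=
      norm_pos_iff.2 (mul_ne_zero (Complex.exp_ne_zero _) h2)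
    simp only [hP, Polynomial.eval_zero, mul_zero, zero_sub, norm_neg] at h1
    linarith
  have hjn := hdeg hP
  set j := P.natDegree
  set n := Q.natDegree
  set l := P.leadingCoeff / Q.leadingCoeff with hl
  have hl0 : l ≠ 0 :=
    div_ne_zero (Polynomial.leadingCoeff_ne_zero.2 hP) (Polynomial.leadingCoeff_ne_zero.2 hQ)
  let R : ℝ → ℂ := fun t => P.eval (t : ℂ) / (t : ℂ) ^ j / (Q.eval (ρ t : ℂ) / (ρ t : ℂ) ^ n)
  have hR : Tendsto R atTop (𝓝 l) :=
    (tendsto_eval_div_pow P le_rfl).div ((tendsto_eval_div_pow Q le_rfl).comp hρlim)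
      (Polynomial.leadingCoeff_ne_zero.2 hQ)
  let r : ℝ → ℝ := fun t => Real.exp (-z.re * (ρ t - t)) * t ^ j / ρ t ^ n
  -- The quotient of the two exponential polynomials factors into the positive size `r`, a rotation
  -- by the lag, and `R`, which tends to `l`.
  have hw : ∀ᶠ t : ℝ in atTop, 0 < r t ∧
      ‖(r t : ℂ) * (Complex.exp (-(z.im * (ρ t - t : ℝ) * Complex.I)) * R t) - 1‖ ≤ 1 / 2 := by
    filter_upwards [hev, hQne, eventually_gt_atTop 0, hρlim.eventually_gt_atTop 0]
      with t h1 h2 h3 h4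
    refine ⟨by positivity, ?_⟩
    have hne : Complex.exp (z * ρ t) * Q.eval (ρ t : ℂ) ≠ 0 :=
      mul_ne_zero (Complex.exp_ne_zero _) h2
    have h5 : (r t : ℂ) * (Complex.exp (-(z.im * (ρ t - t : ℝ) * Complex.I)) * R t) =
        Complex.exp (z * t) * P.eval (t : ℂ) / (Complex.exp (z * ρ t) * Q.eval (ρ t : ℂ)) := by
      have h6 : Complex.exp (z * t) = Complex.exp (z * ρ t) *
          (Complex.exp (-z.re * (ρ t - t)) * Complex.exp (-(z.im * (ρ t - t) * Complex.I))) := by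
        rw [← Complex.exp_add, ← Complex.exp_add]
        congr 1
        linear_combination (t - ρ t : ℂ) * (Complex.re_add_im z).symm
      have h7 : (t : ℂ) ≠ 0 := by exact_mod_cast h3.ne'
      have h8 : (ρ t : ℂ) ≠ 0 := by exact_mod_cast h4.ne'
      have h9 := Complex.exp_ne_zero (z * ρ t)
      simp only [r, R]
      rw [h6]
      push_cast
      field_simp
    rw [h5, div_sub_one hne, norm_div, div_le_iff₀ (norm_pos_iff.2 hne)]
    exact h1
  -- The quotient has modulus at least `1/2` and eventually `‖R t‖ < 2‖l‖`, whence `r t ≥ 1/(4‖l‖)`.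
  -- As `j + 1 ≤ n` and `ρ t ≥ 1`, the power `n` may be lowered to `j + 1`.
  have hlag : Tendsto (fun t => ρ t - t) atTop atTop := by
    have hlpos : 0 < ‖l‖ := norm_pos_iff.2 hl0
    refine tendsto_sub_atTop_of_pow_le hρlim (neg_pos.2 hz) (c := (4 * ‖l‖)⁻¹) (by positivity) j ?_
    filter_upwards [hw, hR.norm.eventually (gt_mem_nhds (show ‖l‖ < 2 * ‖l‖ by linarith)),
      hρlim.eventually_ge_atTop 1] with t h1 h2 h3
    obtain ⟨hr, h1⟩ := h1
    have h4 : 1 / 2 ≤ r t * ‖R t‖ := by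
      have h5 := norm_sub_norm_le (1 : ℂ)
        ((r t : ℂ) * (Complex.exp (-(z.im * (ρ t - t : ℝ) * Complex.I)) * R t))
      rw [norm_sub_rev (1 : ℂ), norm_one, norm_mul, norm_mul, Complex.norm_real,
        Real.norm_of_nonneg hr.le, Complex.norm_exp] at h5
      have h6 : (-(z.im * (ρ t - t : ℝ) * Complex.I)).re = 0 := by
        rw [← Complex.ofReal_mul]; simp
      rw [h6, Real.exp_zero, one_mul] at h5
      linarith
    have h5 : (4 * ‖l‖)⁻¹ ≤ r t := by
      rw [inv_le_iff_one_le_mul₀ (by positivity)]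
      nlinarith
    have h6 : (4 * ‖l‖)⁻¹ * ρ t ^ n ≤ Real.exp (-z.re * (ρ t - t)) * t ^ j := by
      rwa [← le_div_iff₀ (by positivity)]
    refine le_trans ?_ h6
    exact mul_le_mul_of_nonneg_left (pow_le_pow_right₀ h3 hjn) (by positivity)
  have hfreq := frequently_re_exp_mul_nonpos (hρc.sub continuous_id) hlag z.im hlead
  have hv : ∀ᶠ t in atTop, ‖R t / l - 1‖ < 1 / 8 := by
    have := (hR.div_const l).sub_const 1 |>.norm
    rw [div_self hl0, sub_self, norm_zero] at this
    exact this.eventually (gt_mem_nhds (by norm_num))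
  -- At such a time the quotient has real part at least `1/2`, yet replacing `R t` by `l` makes it
  -- nonpositive at a cost of at most `2 * (1/8)`.
  obtain ⟨t, h1, ⟨hr, h2⟩, h3⟩ := (hfreq.and_eventually (hw.and hv)).exists
  set u := Complex.exp (-(z.im * (ρ t - t : ℝ) * Complex.I)) * l with hu
  set v := R t / l with hvdef
  have huv : Complex.exp (-(z.im * (ρ t - t : ℝ) * Complex.I)) * R t = u * v := by
    rw [hu, hvdef]; field_simp
  have h1' : u.re ≤ 0 := h1
  rw [huv] at h2
  have hv1 : 7 / 8 ≤ ‖v‖ := by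
    have := norm_sub_norm_le (1 : ℂ) v
    rw [norm_sub_rev, norm_one] at this
    linarith
  have hnorm : r t * ‖u‖ * ‖v‖ ≤ 3 / 2 := by
    have := norm_sub_norm_le ((r t : ℂ) * (u * v)) 1
    rw [norm_mul, norm_mul, norm_one, Complex.norm_real, Real.norm_of_nonneg hr.le] at this
    linarith
  have hru : r t * ‖u‖ ≤ 2 := by
    have : 0 ≤ r t * ‖u‖ := by positivity
    nlinarith
  have hre : 1 / 2 ≤ ((r t : ℂ) * (u * v)).re := by
    have := (Complex.abs_re_le_norm ((r t : ℂ) * (u * v) - 1)).trans h2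
    rw [Complex.sub_re, Complex.one_re, abs_le] at this
    linarith
  have hsplit : (r t : ℂ) * (u * v) = (r t : ℂ) * u + (r t : ℂ) * u * (v - 1) := by ring
  have hsmall : ((r t : ℂ) * u * (v - 1)).re ≤ 1 / 4 := by
    refine (Complex.re_le_norm _).trans ?_
    rw [norm_mul, norm_mul, Complex.norm_real, Real.norm_of_nonneg hr.le]
    have : r t * ‖u‖ * ‖v - 1‖ ≤ 2 * (1 / 8) :=
      mul_le_mul hru h3.le (norm_nonneg _) (by norm_num)
    linarith
  have hneg : ((r t : ℂ) * u).re ≤ 0 := by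
    rw [Complex.re_ofReal_mul]
    exact mul_nonpos_of_nonneg_of_nonpos hr.le h1'
  rw [hsplit, Complex.add_re] at hre
  linarith

variable {X : Type*} [NormedAddCommGroup X] [NormedSpace ℝ X]
  {Φ : Flow ℝ X} {A : X →L[ℝ] X} {a : ℝ} {m : ℕ}

theorem tendsto_norm_div_of_leading {ψ : X →L[ℝ] ℂ} {z : ℂ} {p : X → Polynomial ℂ} {x : X}
    (hz : z.re = a) (hdeg : (p x).natDegree ≤ m - 1)
    (hψ : ∀ t : ℝ, ψ (Φ t x) = Complex.exp (z * t) * (p x).eval (t : ℂ)) :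
    Tendsto (fun t => ‖ψ (Φ t x)‖ / expPow a (m - 1) t) atTop (𝓝 ‖(p x).coeff (m - 1)‖) := by
  simpa only [hψ, hz] using tendsto_exp_mul_eval_div_expPow z _ hdeg

theorem coeff_eq_zero_of_mem {ψ : X →L[ℝ] ℂ} {z : ℂ} {p : X → Polynomial ℂ} {x : X}
    (hz : z.re = a) (hdeg : (p x).natDegree ≤ m - 1)
    (hψ : ∀ t : ℝ, ψ (Φ t x) = Complex.exp (z * t) * (p x).eval (t : ℂ))
    (hx : x ∈ refinedLyapunovSpace Φ (m - 1) a) : (p x).coeff (m - 1) = 0 := by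
  have h1 := tendsto_norm_div_of_leading hz hdeg hψ
  have h2 : (fun t => ‖ψ (Φ t x)‖) =o[atTop] expPow a (m - 1) :=
    ((ψ.isBigO_comp _ _).trans_isLittleO (mem_refinedLyapunovSpace_iff.1 hx)).norm_left
  exact norm_eq_zero.1 (tendsto_nhds_unique h1 h2.tendsto_div_nhds_zero)

variable [FiniteDimensional ℝ X]

theorem IsTopPair.not_isDistorting (h : IsTopPair A a m) (hΦ : IsLinearFlow Φ)
    (hA : IsGenerator Φ A) {x : X} (hx : x ∉ refinedLyapunovSpace Φ (m - 1) a) {δ : ℝ}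
    (hδ : 0 < δ) : ¬ IsDistorting Φ δ x := by
  intro hdist
  obtain ⟨C, hC, hup⟩ := h.exists_uniform_bound hΦ hA
  obtain ⟨c, hc, hlow⟩ := (h.isBigO_symm hA hx).exists_pos
  -- Chosen so that `κ / (1 - κ) = δ / 2`: a difference of at most `κ‖Φ t x‖` is at most `(δ / 2)‖Φ
  -- t y‖`.
  set κ := δ / (2 + δ) with hκ
  have hκpos : 0 < κ := by positivity
  obtain ⟨y, ⟨hy, -⟩, hlim⟩ := hdist (κ / (C * c)) (by positivity)
  have hlim := hlim id ⟨continuous_id, tendsto_id⟩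
  have hle : limsup (fun t : ℝ => ((‖Φ t x - Φ (id t) y‖ / ‖Φ (id t) y‖ : ℝ) : EReal)) atTop ≤
      ((δ / 2 : ℝ) : EReal) := by
    refine limsup_le_of_le (by isBoundedDefault) ?_
    filter_upwards [hup, hlow.bound, eventually_gt_atTop 0] with t h1 h2 h3
    rw [EReal.coe_le_coe_iff, id]
    refine div_le_of_le_mul₀ (norm_nonneg _) (by positivity) ?_
    have hg := expPow_pos a (m - 1) h3
    rw [Real.norm_of_nonneg hg.le] at h2
    have h4 : ‖Φ t x - Φ t y‖ ≤ κ * ‖Φ t x‖ := by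
      rw [← (hΦ t).map_sub]
      have hxy : ‖x - y‖ ≤ κ / (C * c) := by
        rw [← dist_eq_norm, dist_comm]; exact (Metric.mem_ball.1 hy).le
      calc ‖Φ t (x - y)‖ ≤ C * ‖x - y‖ * expPow a (m - 1) t := h1 _
        _ ≤ C * (κ / (C * c)) * (c * ‖Φ t x‖) := by gcongr
        _ = κ * ‖Φ t x‖ := by field_simp
    have h5 := norm_sub_norm_le (Φ t x) (Φ t y)
    have h6 : κ * (2 + δ) = δ := by rw [hκ]; field_simp
    nlinarith [norm_nonneg (Φ t x), norm_nonneg (Φ t y)]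
  have := hlim.trans hle
  rw [EReal.coe_le_coe_iff] at this
  linarith

theorem IsTopPair.exists_notMem (h : IsTopPair A a m) (hA : IsGenerator Φ A) :
    ∃ x, x ∉ refinedLyapunovSpace Φ (m - 1) a := by
  obtain ⟨ψ, z, p, c, hz, hc, hdeg, hcoeff, hψ⟩ := h.exists_leading_functional hA
  by_contra! hall
  refine hc (LinearMap.ext fun x => ?_)
  rw [← hcoeff, coeff_eq_zero_of_mem hz (hdeg x) (hψ x) (hall x), LinearMap.zero_apply]

/-- Some orbit dominates `expPow a (m - 1)` yet tends to zero, whereas for `a ≥ 0` this function is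
at least `1` from time `1` on. -/
theorem IsTopPair.neg (h : IsTopPair A a m) (hΦ : IsStableFlow Φ) (hA : IsGenerator Φ A) :
    a < 0 := by
  obtain ⟨x, hx⟩ := h.exists_notMem hA
  have h1 := (h.isBigO_symm hA hx).trans_tendsto (hΦ.2 x)
  by_contra! ha
  obtain ⟨t, h2, h3⟩ := ((h1.eventually (gt_mem_nhds zero_lt_one)).and
    (eventually_ge_atTop 1)).exists
  have h4 : 1 ≤ Real.exp (a * t) := Real.one_le_exp (by positivity)
  have h5 : 1 ≤ t ^ (m - 1) := one_le_pow₀ h3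
  have : 1 ≤ expPow a (m - 1) t := one_le_mul_of_one_le_of_one_le h4 h5
  linarith

theorem IsTopPair.exists_isDistorting (h : IsTopPair A a m) (hΦ : IsLinearFlow Φ)
    (hA : IsGenerator Φ A) (ha : a < 0) :
    ∃ δ : ℝ, 0 < δ ∧ ∀ x ∈ refinedLyapunovSpace Φ (m - 1) a, IsDistorting Φ δ x := by
  obtain ⟨ψ, z, p, c, hz, hc, hdeg, hcoeff, hψ⟩ := h.exists_leading_functional hA
  obtain ⟨C, hC, hup⟩ := h.exists_uniform_bound hΦ hA
  obtain ⟨v, hv⟩ : ∃ v, c v ≠ 0 := by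
    by_contra! hall
    exact hc (LinearMap.ext fun x => by simp [hall])
  have hcv : 0 < ‖c v‖ := norm_pos_iff.2 hv
  -- The `4` combines the tolerance `1/2` of `not_eventually_norm_sub_le` with the `1/2` lost in
  -- `hbig`; `1 + C * ‖v‖` is the upper bound in `hsize`. The factor `η` occurs in both bounds and
  -- cancels, so `δ` depends on neither `x` nor `ε`.
  set K := 4 * ((‖ψ‖ + 1) * (1 + C * ‖v‖)) with hK
  have hKpos : 0 < K := by positivity
  refine ⟨‖c v‖ / K, by positivity, fun x hx ε hε => ?_⟩
  have hcx : (p x).coeff (m - 1) = 0 := coeff_eq_zero_of_mem hz (hdeg x) (hψ x) hx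
  -- One of `v` and `-v` puts the quotient of leading coefficients into the closed left half plane.
  obtain ⟨w, hcw, hwv, hre⟩ : ∃ w, ‖c w‖ = ‖c v‖ ∧ ‖w‖ = ‖v‖ ∧
      ((p x).leadingCoeff / c w).re ≤ 0 := by
    rcases le_total ((p x).leadingCoeff / c v).re 0 with h0 | h0
    · exact ⟨v, rfl, rfl, h0⟩
    · exact ⟨-v, by simp, by simp, by simpa [div_neg] using h0⟩
  have hcw0 : c w ≠ 0 := norm_pos_iff.1 (hcw ▸ hcv)
  set η := ε / (2 * (1 + ‖v‖)) with hη
  have hηpos : 0 < η := by positivity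
  set y := x + η • w with hy
  have hcy : (p y).coeff (m - 1) = η * c w := by
    rw [hcoeff, hy, map_add, map_smul, ← hcoeff x, hcx, zero_add, Complex.real_smul]
  have hcy0 : (p y).coeff (m - 1) ≠ 0 := by
    rw [hcy]; exact mul_ne_zero (by exact_mod_cast hηpos.ne') hcw0
  have hndeg : (p y).natDegree = m - 1 :=
    le_antisymm (hdeg y) (Polynomial.le_natDegree_of_ne_zero hcy0)
  have hpy : p y ≠ 0 := fun h0 => hcy0 (by simp [h0])
  have hlc : (p y).leadingCoeff = η * c w := by rw [Polynomial.leadingCoeff, hndeg, hcy]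
  have hnormy : ‖(p y).coeff (m - 1)‖ = η * ‖c v‖ := by
    rw [hcy, norm_mul, Complex.norm_real, Real.norm_of_nonneg hηpos.le, hcw]
  refine ⟨y, ⟨?_, ?_⟩, fun ρ hρ => ?_⟩
  · rw [Metric.mem_ball, hy, dist_self_add_left, norm_smul, Real.norm_of_nonneg hηpos.le, hwv, hη,
      div_mul_eq_mul_div, div_lt_iff₀ (by positivity)]
    nlinarith [norm_nonneg v]
  · intro h0
    have h0 : y = 0 := h0
    rw [hcoeff, h0, map_zero] at hcy0
    exact hcy0 rfl
  by_contra! hlt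
  refine not_eventually_norm_sub_le (hz ▸ ha) hpy (P := p x) ?_ ?_ hρ ?_
  · intro hpx
    rw [hndeg]
    -- Degree `m - 1` is excluded because that coefficient vanishes for `x`. For `m = 1` this forces
    -- `p x = 0`.
    refine lt_of_le_of_ne (hdeg x) fun heq => ?_
    rw [← heq] at hcx
    exact hpx (Polynomial.leadingCoeff_eq_zero.1 hcx)
  · rw [hlc, mul_comm, ← div_div, Complex.div_ofReal_re]
    exact div_nonpos_of_nonpos_of_nonneg hre hηpos.le
  have hbig : ∀ᶠ r in atTop, η * ‖c v‖ / 2 * expPow a (m - 1) r ≤ ‖ψ (Φ r y)‖ := by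
    have h1 := tendsto_norm_div_of_leading hz (hdeg y) (hψ y)
    rw [hnormy] at h1
    filter_upwards [h1.eventually (lt_mem_nhds (half_lt_self (by positivity))),
      eventually_gt_atTop 0] with r h2 h3
    exact ((lt_div_iff₀ (expPow_pos _ _ h3)).1 h2).le
  have hsize : ∀ᶠ r in atTop, ‖Φ r y‖ ≤ η * (1 + C * ‖v‖) * expPow a (m - 1) r := by
    filter_upwards [hup, (mem_refinedLyapunovSpace_iff.1 hx).def hηpos, eventually_gt_atTop 0]
      with r h1 h2 h3
    rw [Real.norm_of_nonneg (expPow_pos _ _ h3).le] at h2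
    rw [hy, (hΦ r).map_add]
    have h4 := h1 (η • w)
    rw [norm_smul, Real.norm_of_nonneg hηpos.le, hwv] at h4
    refine (norm_add_le _ _).trans ((add_le_add h2 h4).trans (le_of_eq ?_))
    ring
  filter_upwards [eventually_lt_of_limsup_lt hlt (by isBoundedDefault), hρ.2.eventually hbig,
    hρ.2.eventually hsize, hρ.2.eventually_gt_atTop 0] with t h1 h2 h3 h4
  rw [← hψ, ← hψ, ← map_sub]
  have hg := expPow_pos a (m - 1) h4
  have hpos : 0 < ‖Φ (ρ t) y‖ := by
    rw [norm_pos_iff]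
    intro h0
    rw [h0, map_zero, norm_zero] at h2
    have : 0 < η * ‖c v‖ / 2 * expPow a (m - 1) (ρ t) := by positivity
    linarith
  rw [EReal.coe_lt_coe_iff, div_lt_iff₀ hpos] at h1
  calc ‖ψ (Φ t x - Φ (ρ t) y)‖ ≤ ‖ψ‖ * ‖Φ t x - Φ (ρ t) y‖ := ψ.le_opNorm _
    _ ≤ (‖ψ‖ + 1) * (‖c v‖ / K * (η * (1 + C * ‖v‖) * expPow a (m - 1) (ρ t))) := by
      gcongr
      · linarith
      · exact h1.le.trans (by gcongr)
    _ = 1 / 2 * (η * ‖c v‖ / 2 * expPow a (m - 1) (ρ t)) := by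
      rw [hK]
      field_simp
      norm_num
    _ ≤ 1 / 2 * ‖ψ (Φ (ρ t) y)‖ := by gcongr

theorem IsTopPair.distortionSet_eq (h : IsTopPair A a m) (hΦ : IsLinearFlow Φ)
    (hA : IsGenerator Φ A) (ha : a < 0) :
    distortionSet Φ = refinedLyapunovSpace Φ (m - 1) a := by
  refine Subset.antisymm (fun x hx => ?_) fun x hx => ?_
  · obtain ⟨δ, hδ, hx⟩ := mem_iUnion₂.1 hx
    by_contra hcon
    exact h.not_isDistorting hΦ hA hcon hδ hx
  · obtain ⟨δ, hδ, hall⟩ := h.exists_isDistorting hΦ hA ha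
    exact mem_iUnion₂.2 ⟨δ, hδ, hall x hx⟩

end

/-! ### Lyapunov exponents and the identification of the two numbers -/

theorem tendsto_log_mul_expPow_div {a c : ℝ} (hc : 0 < c) (n : ℕ) :
    Tendsto (fun t => Real.log (c * expPow a n t) / t) atTop (𝓝 a) := by
  have h1 : Tendsto (fun t : ℝ => Real.log c / t) atTop (𝓝 0) :=
    tendsto_const_nhds.div_atTop tendsto_id
  have h2 : Tendsto (fun t : ℝ => (n : ℝ) * (Real.log t / t)) atTop (𝓝 ((n : ℝ) * 0)) :=
    Real.isLittleO_log_id_atTop.tendsto_div_nhds_zero.const_mul _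
  have h3 := (h1.add_const a).add h2
  rw [mul_zero, zero_add, add_zero] at h3
  refine h3.congr' ?_
  filter_upwards [eventually_gt_atTop 0] with t ht
  rw [expPow, Real.log_mul hc.ne' (by positivity), Real.log_mul (by positivity) (by positivity),
    Real.log_exp, Real.log_pow]
  field_simp
  ring

theorem le_lyapunovExponent_of_isBigO {X : Type*} [NormedAddCommGroup X] {Φ : Flow ℝ X}
    {a : ℝ} {n : ℕ} {x : X} (hx : x ≠ 0) (h : expPow a n =O[atTop] (fun t => Φ t x)) :
    (a : EReal) ≤ lyapunovExponent Φ x := by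
  rw [lyapunovExponent, if_neg hx]
  obtain ⟨c, hc, hb⟩ := h.exists_pos
  have hlim := (continuous_coe_real_ereal.tendsto a).comp
    (tendsto_log_mul_expPow_div (a := a) (inv_pos.2 hc) n)
  rw [← hlim.limsup_eq]
  refine limsup_le_limsup ?_ (by isBoundedDefault) (by isBoundedDefault)
  filter_upwards [hb.bound, eventually_gt_atTop 0] with t h1 h2
  have h3 := expPow_pos a n h2
  rw [Real.norm_of_nonneg h3.le] at h1
  rw [Function.comp_apply, EReal.coe_le_coe_iff]
  have : c⁻¹ * expPow a n t ≤ ‖Φ t x‖ := by rwa [inv_mul_le_iff₀ hc]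
  gcongr

variable {X : Type*} [NormedAddCommGroup X] [NormedSpace ℝ X]

theorem IsLinearFlow.apply_ne_zero {Φ : Flow ℝ X} (hΦ : IsLinearFlow Φ) {x : X} (hx : x ≠ 0)
    (t : ℝ) : Φ t x ≠ 0 := by
  intro h
  have h1 : Φ (-t) (Φ t x) = 0 := by rw [h, (hΦ _).map_zero]
  rw [← Φ.map_add, neg_add_cancel, Φ.map_zero_apply] at h1
  exact hx h1

theorem lyapunovExponent_le_of_isBigO {Φ : Flow ℝ X} (hΦ : IsLinearFlow Φ) {a : ℝ} {n : ℕ} {x : X}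
    (h : (fun t => Φ t x) =O[atTop] expPow a n) : lyapunovExponent Φ x ≤ (a : EReal) := by
  rw [lyapunovExponent]
  split_ifs with hx
  · exact bot_le
  obtain ⟨c, hc, hb⟩ := h.exists_pos
  have hlim := (continuous_coe_real_ereal.tendsto a).comp
    (tendsto_log_mul_expPow_div (a := a) hc n)
  rw [← hlim.limsup_eq]
  refine limsup_le_limsup ?_ (by isBoundedDefault) (by isBoundedDefault)
  filter_upwards [hb.bound, eventually_gt_atTop 0] with t h1 h2
  rw [Real.norm_of_nonneg (expPow_pos a n h2).le] at h1
  rw [Function.comp_apply, EReal.coe_le_coe_iff]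
  have := norm_pos_iff.2 (hΦ.apply_ne_zero hx t)
  gcongr

namespace IsTopPair

variable [FiniteDimensional ℝ X] {Φ : Flow ℝ X} {A : X →L[ℝ] X} {a : ℝ} {m : ℕ}

theorem lyapunovSpace_eq_univ (h : IsTopPair A a m) (hΦ : IsLinearFlow Φ) (hA : IsGenerator Φ A) :
    lyapunovSpace Φ a = univ :=
  eq_univ_of_forall fun x => lyapunovExponent_le_of_isBigO hΦ (h.isBigO hA x)

theorem exists_lyapunovExponent_eq (h : IsTopPair A a m) (hΦ : IsLinearFlow Φ)
    (hA : IsGenerator Φ A) : ∃ x : X, x ≠ 0 ∧ lyapunovExponent Φ x = (a : EReal) := by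
  obtain ⟨x, hx⟩ := h.exists_notMem hA
  have hx0 : x ≠ 0 := by
    rintro rfl
    exact hx (hΦ.refinedLyapunovSubmodule (m - 1) a).zero_mem
  exact ⟨x, hx0, le_antisymm (lyapunovExponent_le_of_isBigO hΦ (h.isBigO hA x))
    (le_lyapunovExponent_of_isBigO hx0 (h.isBigO_symm hA hx))⟩

theorem isGreatest_lyapunovExponents (h : IsTopPair A a m) (hΦ : IsLinearFlow Φ)
    (hA : IsGenerator Φ A) : IsGreatest (lyapunovExponents Φ) a := by
  refine ⟨h.exists_lyapunovExponent_eq hΦ hA, ?_⟩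
  rintro s ⟨x, -, hs⟩
  rw [← EReal.coe_le_coe_iff, ← hs]
  exact lyapunovExponent_le_of_isBigO hΦ (h.isBigO hA x)

theorem isLeast_lyapunovSpace (h : IsTopPair A a m) (hΦ : IsLinearFlow Φ)
    (hA : IsGenerator Φ A) : IsLeast {s : ℝ | lyapunovSpace Φ s = univ} a := by
  refine ⟨h.lyapunovSpace_eq_univ hΦ hA, fun s hs => ?_⟩
  obtain ⟨x, -, hx⟩ := h.exists_lyapunovExponent_eq hΦ hA
  have hmem : x ∈ lyapunovSpace Φ s := by
    rw [show lyapunovSpace Φ s = univ from hs]; trivial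
  rw [← EReal.coe_le_coe_iff, ← hx]
  exact hmem

/-- All orbits are `O(e^{at} t^(m-1))`, hence of smaller order than `e^{at} t^m`; an orbit of exact
order `e^{at} t^(m-1)` excludes every `k ≤ m - 1`. -/
theorem isLeast_refinedLyapunovSpace (h : IsTopPair A a m) (hA : IsGenerator Φ A) :
    IsLeast {k : ℕ | refinedLyapunovSpace Φ k a = univ} m := by
  have hm := h.one_le
  refine ⟨eq_univ_of_forall fun x => mem_refinedLyapunovSpace_iff.2
    ((h.isBigO hA x).trans_isLittleO (expPow_isLittleO_of_lt a (by omega))), fun k hk => ?_⟩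
  obtain ⟨x, hx⟩ := h.exists_notMem hA
  by_contra! hlt
  have hmem : x ∈ refinedLyapunovSpace Φ k a := by
    rw [show refinedLyapunovSpace Φ k a = univ from hk]; trivial
  exact hx (mem_refinedLyapunovSpace_iff.2 ((mem_refinedLyapunovSpace_iff.1 hmem).trans_isBigO
    (expPow_isBigO_of_le a (by omega))))

theorem topExponent_eq (h : IsTopPair A a m) (hΦ : IsLinearFlow Φ) (hA : IsGenerator Φ A) :
    topExponent Φ = a :=
  (h.isGreatest_lyapunovExponents hΦ hA).csSup_eq

theorem topIndex_eq (h : IsTopPair A a m) (hΦ : IsLinearFlow Φ) (hA : IsGenerator Φ A) :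
    topIndex Φ = m := by
  rw [topIndex, h.topExponent_eq hΦ hA, refinedIndex, h.lyapunovSpace_eq_univ hΦ hA]
  exact (h.isLeast_refinedLyapunovSpace hA).csInf_eq

end IsTopPair

end LinFlow

end

theorem theorem3p5 {X : Type*} [NormedAddCommGroup X] [NormedSpace ℝ X] [FiniteDimensional ℝ X]
    [Nontrivial X] (Φ : Flow ℝ X) (hΦ : LinFlow.IsStableFlow Φ) :
    -- the set of distortion points is the refined Lyapunov space
    LinFlow.distortionSet Φ
        = LinFlow.refinedLyapunovSpace Φ (LinFlow.topIndex Φ - 1) (LinFlow.topExponent Φ) ∧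
    -- it is a proper invariant subspace
    (∃ V : Submodule ℝ X, (V : Set X) = LinFlow.distortionSet Φ ∧ V ≠ ⊤ ∧
      ∀ t : ℝ, (fun x => Φ t x) '' (V : Set X) = (V : Set X)) ∧
    -- the extrema that define the two numbers are attained, and `m - 1` is a true subtraction
    IsGreatest (LinFlow.lyapunovExponents Φ) (LinFlow.topExponent Φ) ∧
    IsLeast {s : ℝ | LinFlow.lyapunovSpace Φ s = Set.univ} (LinFlow.topExponent Φ) ∧
    IsLeast {m : ℕ | LinFlow.refinedLyapunovSpace Φ m (LinFlow.topExponent Φ) = Set.univ}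
      (LinFlow.topIndex Φ) ∧
    1 ≤ LinFlow.topIndex Φ ∧
    -- the two numbers in terms of eigenvalues and Jordan blocks of the generator
    (∃ A : X →L[ℝ] X, LinFlow.IsGenerator Φ A ∧
      IsGreatest {a : ℝ | ∃ z : ℂ, (LinFlow.complexify A).HasEigenvalue z ∧ z.re = a}
        (LinFlow.topExponent Φ) ∧
      IsGreatest {k : ℕ | ∃ z : ℂ, z.re = LinFlow.topExponent Φ ∧
        LinFlow.HasJordanChain (LinFlow.complexify A) z k} (LinFlow.topIndex Φ)) := by
  have hlin := hΦ.1
  obtain ⟨A, hA⟩ := hlin.exists_isGenerator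
  obtain ⟨a, m, h⟩ := LinFlow.exists_isTopPair A
  rw [h.topExponent_eq hlin hA, h.topIndex_eq hlin hA]
  have hD := h.distortionSet_eq hlin hA (h.neg hΦ hA)
  refine ⟨hD, ⟨hlin.refinedLyapunovSubmodule (m - 1) a, hD.symm, fun htop => ?_,
    hlin.image_refinedLyapunovSpace (m - 1) a⟩, h.isGreatest_lyapunovExponents hlin hA,
    h.isLeast_lyapunovSpace hlin hA, h.isLeast_refinedLyapunovSpace hA, h.one_le, A, hA, ?_, ?_⟩
  · obtain ⟨x, hx⟩ := h.exists_notMem hA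
    have hmem : x ∈ hlin.refinedLyapunovSubmodule (m - 1) a := htop ▸ Submodule.mem_top
    exact hx hmem
  · simpa only [← LinFlow.hasJordanChain_one_iff, LinFlow.hasJordanChain_transposeEnd_iff]
      using h.eigenvalue
  · simpa only [LinFlow.hasJordanChain_transposeEnd_iff] using h.chain
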